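/- **Setting.** Let $\mathfrak L$ be a countable relational language. A *smooth class* $(\mathcal C,\leqslant)$ consists of a class $\mathcal C$ of finite $\mathfrak L$-structures, closed under isomorphism and substructure and containing an empty structure, and a reflexive, transitive, isomorphism-invariant relation $A\leqslant B$ between members $A\subseteq B$ of $\mathcal C$ such that $A_1\leqslant A$ and $A_2\subseteq A$ imply $A_1\cap A_2\leqslant A_2$. For a structure $\mathcal N$ whose finite substructures all lie in $\mathcal C$, and a finite $A\subseteq\mathcal N$, write $A\leqslant\mathcal N$ if $A\leqslant T$ for all finite substructures $T$ with $A\subseteq T\subseteq\mathcal N$. A *$\leqslant$-embedding* of $A$ into $\mathcal N$ is an embedding $\Gamma$ with $\Gamma[A]\leqslant\mathcal N$, and then $\Gamma[A]$ is a *$\leqslant$-closed copy* of $A$ in $\mathcal N$. The class has AP if any two $\leqslant$-embeddings $A\to B$, $A\to C$ in $\mathcal C$ can be completed to a commutative square by $\leqslant$-embeddings $B\to D$, $C\to D$ with $D\in\mathcal C$. A countable structure $\mathcal M$ is $(\mathcal C,\leqslant)$-*generic* if (1) its finite substructures are, up to isomorphism, exactly the members of $\mathcal C$; (2) it is the union of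 an increasing sequence of finite substructures $A_i\leqslant\mathcal M$; (3) for every $\leqslant$-embedding $i:A\to B$ in $\mathcal C$, every $\leqslant$-embedding $A\to\mathcal M$ is of the form $g\circ i$ for a $\leqslant$-embedding $g:B\to\mathcal M$. **Free pseudoplanes.** Let $A,B\in\mathcal C$ and let $\mathcal M$ be generic. An *$A$-point* is a $\leqslant$-closed copy of $A$ in $\mathcal M$; a *$B$-line* is a $\leqslant$-embedding $\Lambda:B\to\mathcal M$ (distinct embeddings are distinct lines); it lies in $X\subseteq\mathcal M$ if $\Lambda[B]\subseteq X$, and an $A$-point lies on $\Lambda$ if it is contained in $\Lambda[B]$. The pair $(A;B)$ *forms a free $k$-pseudoplane* in a finite $X\subseteq\mathcal M$ if there is an enumeration without repetition $\Lambda_0,\dots,\Lambda_{b-1}$ of all $B$-lines in $X$ such that the following process ends with no $A$-point lying on a remaining line: start with all $B$-lines in $X$; at step $i$ delete $\Lambda_i$ if at most $k$ of the $A$-points on $\Lambda_i$ lie on other remaining lines, and keep it otherwise. It forms a free $k$-pseudoplane (in $\mathcal M$) if it does so in every finite $X\subseteq\mathcal M$. **Matrices.** Let $\mathrm X$ be an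 $m\times n$ matrix with entries in $\{0,1\}$. It satisfies the *$k$-configuration exhibition condition* if $k\le n$ and for all columns $l_1<\dots<l_k$ and all $\sigma\in\{0,1\}^k$ some row $j$ has $\mathrm X_{j l_i}=\sigma_i$ for $1\le i\le k$. It satisfies the *convex Ramsey condition* if there is a probability vector $\mathrm P$ ($1\times m$) with $\mathrm P\,\mathrm X\,\mathrm W\le\frac12$ for every $n\times 1$ matrix $\mathrm W$ having exactly one entry $1$, exactly one entry $-1$ and all others $0$. A topological group is *amenable* if every continuous action of it on a nonempty compact Hausdorff space has an invariant Borel probability measure; $\mathrm{Aut}(\mathcal M)$ carries the topology of pointwise convergence. **Theorem.** Let $(\mathcal C,\leqslant)$ be a smooth class with AP and let $\mathcal M$ be the $(\mathcal C,\leqslant)$-generic structure. Let $2\le k<n$ be integers and let $A,B\in\mathcal C$ be such that there are exactly $n$ $\leqslant$-closed copies of $A$ in $B$, there is at least one $\leqslant$-embedding of $B$ into $\mathcal M$ (this is automatic if $\emptyset\leqslant C$ for all $C\in\mathcal C$), and $(A;B)$ forms a free $k$-pseudoplane in $\mathcal M$. Suppose that for some $m$ there is an $m\times n$ matrix with entries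 in $\{0,1\}$ that satisfies the $k$-configuration exhibition condition but not the convex Ramsey condition. Then $\mathrm{Aut}(\mathcal M)$ is not amenable. -/

import Mathlib

open FirstOrder CategoryTheory MeasureTheory

universe u v w

set_option linter.unusedVariables false

/-! ## Smooth classes -/

/-- A type with an `L`-structure, as a bundled structure. -/
abbrev bundle (L : FirstOrder.Language.{u, v}) (B : Type w) [h : L.Structure B] :
    Bundled.{w} L.Structure :=
  ⟨B, h⟩

/-- A smooth class `(𝒞, ≤)` of finite structures in a relational language `L`.
For `S : L.Substructure B`, the proposition `le S` is the relation `S ≤ B`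
(only its values for `B ∈ 𝒞` matter). -/
structure SmoothClass (L : FirstOrder.Language.{u, v}) where
  /-- the class `𝒞` -/
  carrier : Set (Bundled.{w} L.Structure)
  finite_of_mem : ∀ (B : Type w) [L.Structure B], bundle L B ∈ carrier → Finite B
  /-- `𝒞` is closed under isomorphism and substructure -/
  mem_of_embedding : ∀ (A B : Type w) [L.Structure A] [L.Structure B],
    bundle L B ∈ carrier → Nonempty (A ↪[L] B) → bundle L A ∈ carrier
  /-- `∅ ∈ 𝒞` -/
  exists_empty : ∃ E ∈ carrier, IsEmpty E
  /-- the relation `S ≤ B` -/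
  le : ∀ {B : Type w} [L.Structure B], L.Substructure B → Prop
  le_refl : ∀ (B : Type w) [L.Structure B], bundle L B ∈ carrier → le (⊤ : L.Substructure B)
  /-- if `S ≤ T` and `T ≤ B` then `S ≤ B`, where `S ⊆ T ⊆ B` -/
  le_trans : ∀ (B : Type w) [L.Structure B], bundle L B ∈ carrier →
    ∀ S T : L.Substructure B, S ≤ T → le (S.comap T.subtype.toHom) → le T → le S
  /-- invariance under isomorphism -/
  le_map : ∀ (B B' : Type w) [L.Structure B] [L.Structure B'], bundle L B ∈ carrier →
    ∀ (e : B ≃[L] B') (S : L.Substructure B), le S → le (S.map e.toHom)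
  /-- if `S ≤ B` and `T ⊆ B` then `S ∩ T ≤ T` -/
  le_inter : ∀ (B : Type w) [L.Structure B], bundle L B ∈ carrier →
    ∀ S T : L.Substructure B, le S → le (S.comap T.subtype.toHom)

namespace SmoothClass

variable {L : FirstOrder.Language.{u, v}} (𝒞 : SmoothClass.{u, v, w} L)

/-- `Emb(B, A)` for `B ∈ 𝒞`: the embeddings `Γ : A → B` with `Γ[A] ≤ B`. -/
def Emb (B A : Type w) [L.Structure B] [L.Structure A] : Set (A ↪[L] B) :=
  {Γ | 𝒞.le Γ.toHom.range}

/-- The amalgamation property of `(𝒞, ≤)`. -/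
def AP : Prop :=
  ∀ (A B C : Type w) [L.Structure A] [L.Structure B] [L.Structure C],
    bundle L A ∈ 𝒞.carrier → bundle L B ∈ 𝒞.carrier → bundle L C ∈ 𝒞.carrier →
    ∀ i ∈ 𝒞.Emb B A, ∀ j ∈ 𝒞.Emb C A,
      ∃ D : Bundled.{w} L.Structure, D ∈ 𝒞.carrier ∧
        ∃ f ∈ 𝒞.Emb D B, ∃ g ∈ 𝒞.Emb D C, f.comp i = g.comp j

/-- `S ≤ N` for an arbitrary structure `N` all of whose finite substructures are in `𝒞`:
`S ≤ T` for every finite substructure `T` of `N` that contains `S`. -/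
def ClosedIn {N : Type w} [L.Structure N] (S : L.Substructure N) : Prop :=
  ∀ T : L.Substructure N, (T : Set N).Finite → S ≤ T → 𝒞.le (S.comap T.subtype.toHom)

/-- `Emb(N, A)` for an arbitrary structure `N`: the embeddings `Γ : A → N` with `Γ[A] ≤ N`. -/
def EmbIn (N A : Type w) [L.Structure N] [L.Structure A] : Set (A ↪[L] N) :=
  {Γ | 𝒞.ClosedIn Γ.toHom.range}

/-- `M` is the `(𝒞, ≤)`-generic structure (countability of `M` is a separate assumption). -/
structure IsGeneric (M : Type w) [L.Structure M] : Prop where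
  age_eq : L.age M = 𝒞.carrier
  exists_chain : ∃ S : ℕ → L.Substructure M, Monotone S ∧
    (∀ i, (S i : Set M).Finite ∧ 𝒞.ClosedIn (S i)) ∧ ∀ x : M, ∃ i, x ∈ S i
  extension : ∀ (A B : Type w) [L.Structure A] [L.Structure B],
    bundle L A ∈ 𝒞.carrier → bundle L B ∈ 𝒞.carrier →
    ∀ i ∈ 𝒞.Emb B A, ∀ f ∈ 𝒞.EmbIn M A, ∃ g ∈ 𝒞.EmbIn M B, g.comp i = f

/-! ## Points, lines and free pseudoplanes -/

/-- The `≤`-closed copies `Γ[A]`, `Γ ∈ Emb(B, A)`, of `A` in `B ∈ 𝒞`. -/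
def copies (B A : Type w) [L.Structure B] [L.Structure A] : Set (L.Substructure B) :=
  (fun Γ : A ↪[L] B => Γ.toHom.range) '' 𝒞.Emb B A

/-- The `A`-points of `M`: the `≤`-closed copies `Γ[A]`, `Γ ∈ Emb(M, A)`, of `A` in `M`. -/
def points (M A : Type w) [L.Structure M] [L.Structure A] : Set (L.Substructure M) :=
  (fun Γ : A ↪[L] M => Γ.toHom.range) '' 𝒞.EmbIn M A

/-- The `B`-lines in `X ⊆ M`: the embeddings `Λ ∈ Emb(M, B)` with `Λ[B] ⊆ X`. -/
def lines {M : Type w} (B : Type w) [L.Structure M] [L.Structure B] (X : L.Substructure M) :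
    Set (B ↪[L] M) :=
  {Λ | Λ ∈ 𝒞.EmbIn M B ∧ Λ.toHom.range ≤ X}

/-- The set of the `A`-points on the `B`-line `Λ` that also lie on another line of `𝓛`. -/
def sharedPoints {M B : Type w} (A : Type w) [L.Structure M] [L.Structure B] [L.Structure A]
    (𝓛 : Set (B ↪[L] M)) (Λ : B ↪[L] M) : Set (L.Substructure M) :=
  {P | P ∈ 𝒞.points M A ∧ P ≤ Λ.toHom.range ∧ ∃ Λ' ∈ 𝓛, Λ' ≠ Λ ∧ P ≤ Λ'.toHom.range}

open Classical in
/-- The lines that remain of `𝓛` when the lines of a list are treated one after the other: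
a line `Λ` is deleted (everything of it except what it shares with the other remaining lines goes)
if at most `k` of its `A`-points lie on other remaining lines, and it is kept otherwise. -/
noncomputable def remaining {M B : Type w} (A : Type w) [L.Structure M] [L.Structure B]
    [L.Structure A] (k : ℕ) : Set (B ↪[L] M) → List (B ↪[L] M) → Set (B ↪[L] M)
  | 𝓛, [] => 𝓛
  | 𝓛, Λ :: l =>
    remaining A k (if (𝒞.sharedPoints A 𝓛 Λ).encard ≤ k then 𝓛 \ {Λ} else 𝓛) l

/-- `(A; B)` forms a free `k`-pseudoplane in the finite `X ⊆ M`: for some enumeration, without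
repetition, of all `B`-lines in `X`, no `A`-point lies on a line that remains at the end. -/
def IsFreePseudoplaneIn {M : Type w} (A B : Type w) [L.Structure M] [L.Structure A]
    [L.Structure B] (k : ℕ) (X : L.Substructure M) : Prop :=
  ∃ l : List (B ↪[L] M), l.Nodup ∧ (∀ Λ, Λ ∈ l ↔ Λ ∈ 𝒞.lines B X) ∧
    ∀ Λ ∈ 𝒞.remaining A k (𝒞.lines B X) l, ∀ P ∈ 𝒞.points M A, ¬ P ≤ Λ.toHom.range

/-- `(A; B)` forms a free `k`-pseudoplane in `M`: it does so in every finite `X ⊆ M`. -/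
def IsFreePseudoplane (M A B : Type w) [L.Structure M] [L.Structure A] [L.Structure B]
    (k : ℕ) : Prop :=
  ∀ X : L.Substructure M, (X : Set M).Finite → 𝒞.IsFreePseudoplaneIn A B k X

end SmoothClass

/-! ## Matrices -/

/-- All entries are `0` or `1`. -/
def IsZeroOne {r m : ℕ} (C : Matrix (Fin r) (Fin m) ℝ) : Prop :=
  ∀ i j, C i j = 0 ∨ C i j = 1

/-- The `k`-configuration exhibition condition. -/
def ExhibitsConfigurations {r m : ℕ} (k : ℕ) (C : Matrix (Fin r) (Fin m) ℝ) : Prop :=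
  IsZeroOne C ∧ k ≤ m ∧
    ∀ σ : Fin k → ℝ, (∀ i, σ i = 0 ∨ σ i = 1) → ∀ l : Fin k → Fin m, StrictMono l →
      ∃ j, ∀ i, C j (l i) = σ i

/-- Dirac-weight matrices: one entry `1`, one entry `-1`, all others `0`. -/
def IsDiracWeight {m : ℕ} (W : Fin m → ℝ) : Prop :=
  ∃ a b, a ≠ b ∧ W a = 1 ∧ W b = -1 ∧ ∀ c, c ≠ a → c ≠ b → W c = 0

/-- Probability matrices. -/
def IsProbability {t : ℕ} (P : Fin t → ℝ) : Prop :=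
  (∀ i, 0 ≤ P i) ∧ ∑ i, P i = 1

/-- The convex Ramsey condition for a matrix. -/
def IsConvexRamsey {r m : ℕ} (Y : Matrix (Fin r) (Fin m) ℝ) : Prop :=
  ∃ P : Fin r → ℝ, IsProbability P ∧
    ∀ W : Fin m → ℝ, IsDiracWeight W → P ⬝ᵥ (Matrix.mulVec Y W) ≤ 1 / 2

/-! ## Automorphism groups and amenability -/

/-- The automorphism group of a structure. -/
instance autGroup (L : FirstOrder.Language.{u, v}) (M : Type w) [L.Structure M] : Group (M ≃[L] M) where
  mul g h := g.comp h
  one := FirstOrder.Language.Equiv.refl L M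
  inv g := g.symm
  mul_assoc _ _ _ := rfl
  one_mul _ := rfl
  mul_one _ := rfl
  inv_mul_cancel g := FirstOrder.Language.Equiv.ext fun x => g.symm_apply_apply x

/-- The topology of pointwise convergence on the automorphism group (`M` is discrete). -/
instance autTopology (L : FirstOrder.Language.{u, v}) (M : Type w) [L.Structure M] :
    TopologicalSpace (M ≃[L] M) :=
  TopologicalSpace.induced (fun g => (g : M → M)) (@Pi.topologicalSpace M (fun _ => M) fun _ => ⊥)

/-- A topological group is amenable if every continuous action on a nonempty compact Hausdorff space
has an invariant Borel probability measure. -/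
def IsAmenable (G : Type w) [Group G] [TopologicalSpace G] : Prop :=
  ∀ (X : Type w) [TopologicalSpace X] [CompactSpace X] [T2Space X] [Nonempty X]
    [MeasurableSpace X] [BorelSpace X] [MulAction G X] [ContinuousSMul G X],
    ∃ μ : Measure X, IsProbabilityMeasure μ ∧ ∀ g : G, μ.map (fun x => g • x) = μ

/-! Color `A`-points with two colors so that on every `B`-line the colors of its `n` points spell a
row of `X`. Inside a finite substructure this is done by running the deletion process backwards: a
line being put back shares at most `k` points with the lines already colored, and configuration
exhibition supplies a row with the prescribed entries there (`exists_rowColored_insert`).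
Compactness yields global colorings, which form a nonempty compact `Aut(M)`-invariant space
(`rowColorings_nonempty`).

If `Aut(M)` were amenable, this space would carry an invariant probability measure. The row read on
a fixed line then becomes random; let `P` be its distribution. By back-and-forth (`homogeneous`)
automorphisms move any `A`-point of the line to any other, so all positions have color `1` with the
same probability. Hence `P X` is constant and `P X W = 0` for every Dirac weight `W`, which gives
the convex Ramsey condition, a contradiction (`isConvexRamsey_of_measure`). -/

namespace SmoothClass

/-! ### Closed embeddings and their composition -/

variable {L : FirstOrder.Language.{u, v}} {𝒞 : SmoothClass.{u, v, w} L}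

theorem comp_mem_Emb {A B N : Type w} [L.Structure A] [L.Structure B] [L.Structure N]
    (hB : bundle L B ∈ 𝒞.carrier) (hN : bundle L N ∈ 𝒞.carrier)
    {f : B ↪[L] N} (hf : f ∈ 𝒞.Emb N B) {g : A ↪[L] B} (hg : g ∈ 𝒞.Emb B A) :
    f.comp g ∈ 𝒞.Emb N A := by
  refine 𝒞.le_trans N hN _ f.toHom.range ?_ ?_ hf
  · rintro _ ⟨a, rfl⟩
    exact ⟨g a, rfl⟩
  · have h := 𝒞.le_map B _ hB f.equivRange _ hg
    convert h using 1
    ext ⟨x, hx⟩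
    constructor
    · rintro ⟨a, ha⟩
      exact ⟨g a, ⟨a, rfl⟩, Subtype.ext ha⟩
    · rintro ⟨_, ⟨a, rfl⟩, ha⟩
      exact ⟨a, congrArg Subtype.val ha⟩

namespace IsGeneric

variable {M : Type w} [L.Structure M]

theorem mem_carrier (hM : 𝒞.IsGeneric M) (T : L.Substructure M)
    (hT : (T : Set M).Finite) : bundle L T ∈ 𝒞.carrier := by
  rw [← hM.age_eq]
  have : Finite T := hT
  exact ⟨FirstOrder.Language.Structure.FG.of_finite, ⟨T.subtype⟩⟩

theorem closedIn_map (hM : 𝒞.IsGeneric M) (e : M ≃[L] M) {S : L.Substructure M}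
    (hS : 𝒞.ClosedIn S) : 𝒞.ClosedIn (S.map e.toHom) := by
  intro T hT hST
  obtain ⟨T, rfl⟩ : ∃ T' : L.Substructure M, T'.map e.toEmbedding.toHom = T :=
    ⟨_, FirstOrder.Language.Substructure.map_comap_eq_of_surjective e.surjective T⟩
  have hT' : (T : Set M).Finite := Set.Finite.of_finite_image hT e.injective.injOn
  have hST' : S ≤ T := by
    intro x hx
    obtain ⟨y, hy, hxy⟩ := hST ⟨x, hx, rfl⟩
    rwa [← e.injective hxy]
  have h := 𝒞.le_map T _ (hM.mem_carrier T hT') (e.toEmbedding.substructureEquivMap T) _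
    (hS T hT' hST')
  convert h using 1
  ext ⟨x, hx⟩
  constructor
  · rintro ⟨y, hy, hxy⟩
    exact ⟨⟨y, hST' hy⟩, hy, Subtype.ext hxy⟩
  · rintro ⟨y, hy, hxy⟩
    exact ⟨y, hy, congrArg Subtype.val hxy⟩

theorem equiv_comp_mem_EmbIn (hM : 𝒞.IsGeneric M) (e : M ≃[L] M) {B : Type w} [L.Structure B]
    {f : B ↪[L] M} (hf : f ∈ 𝒞.EmbIn M B) : e.toEmbedding.comp f ∈ 𝒞.EmbIn M B := by
  have h := hM.closedIn_map e hf
  rw [← FirstOrder.Language.Hom.range_comp] at h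
  exact h

theorem codRestrict_mem_Emb (hM : 𝒞.IsGeneric M) {B : Type w} [L.Structure B]
    {f : B ↪[L] M} (hf : f ∈ 𝒞.EmbIn M B) {T : L.Substructure M} (hT : (T : Set M).Finite)
    (h : ∀ b, f b ∈ T) : f.codRestrict T h ∈ 𝒞.Emb T B := by
  have h' := hf T hT (by rintro _ ⟨b, rfl⟩; exact h b)
  change 𝒞.le _
  convert h' using 1
  ext ⟨x, hx⟩
  constructor
  · rintro ⟨b, hb⟩
    exact ⟨b, congrArg Subtype.val hb⟩
  · rintro ⟨b, hb⟩
    exact ⟨b, Subtype.ext hb⟩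

/-- A finite `T` containing the image of `A` need not contain that of `B`. So one works in `T ∪
f[B]`, which is a substructure as `L` is relational, and intersects with `T` afterwards. -/
theorem comp_mem_EmbIn [L.IsRelational] (hM : 𝒞.IsGeneric M) {A B : Type w} [L.Structure A]
    [L.Structure B] (hB : bundle L B ∈ 𝒞.carrier) {f : B ↪[L] M} (hf : f ∈ 𝒞.EmbIn M B)
    {g : A ↪[L] B} (hg : g ∈ 𝒞.Emb B A) : f.comp g ∈ 𝒞.EmbIn M A := by
  intro T hT hgT
  have := 𝒞.finite_of_mem B hB
  let T' : L.Substructure M :=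
    FirstOrder.Language.Substructure.closure L ((T : Set M) ∪ Set.range f)
  have hT'eq : (T' : Set M) = (T : Set M) ∪ Set.range f :=
    FirstOrder.Language.Substructure.closure_eq_of_isRelational L _
  have hT' : (T' : Set M).Finite := hT'eq ▸ hT.union (Set.finite_range f)
  have hTT' : T ≤ T' := fun x hx => hT'eq.ge (Or.inl hx)
  have hfT' : ∀ b, f b ∈ T' := fun b => hT'eq.ge (Or.inr ⟨b, rfl⟩)
  have h1 := comp_mem_Emb hB (hM.mem_carrier T' hT') (hM.codRestrict_mem_Emb hf hT' hfT') hg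
  let ι := FirstOrder.Language.Substructure.inclusion hTT'
  have h2 := 𝒞.le_inter T' (hM.mem_carrier T' hT') _ ι.toHom.range h1
  have hmem : bundle L ι.toHom.range ∈ 𝒞.carrier :=
    𝒞.mem_of_embedding _ T' (hM.mem_carrier T' hT') ⟨FirstOrder.Language.Substructure.subtype _⟩
  -- `h2` speaks of the copy of `T` inside `T'`; this carries it back to `T` itself.
  have h3 := 𝒞.le_map _ T hmem ι.equivRange.symm _ h2
  convert h3 using 1
  ext ⟨x, hx⟩
  constructor
  · rintro ⟨a, ha⟩
    refine ⟨ι.equivRange ⟨x, hx⟩, ⟨a, Subtype.ext ha⟩, ?_⟩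
    exact ι.equivRange.symm_apply_apply _
  · rintro ⟨y, ⟨a, ha⟩, hy⟩
    have hy' : y = ι.equivRange ⟨x, hx⟩ := by
      rw [← hy]
      exact (ι.equivRange.apply_symm_apply y).symm
    subst hy'
    exact ⟨a, congrArg Subtype.val ha⟩

/-! ### Back-and-forth and homogeneity -/

/-- The graph of a partial isomorphism of `M` between finite closed substructures. -/
def IsClosedPartialIso (𝒞 : SmoothClass.{u, v, w} L) {M : Type w} [L.Structure M]
    (R : Set (M × M)) : Prop :=
  ∃ (C : Bundled.{w} L.Structure), C ∈ 𝒞.carrier ∧ ∃ f ∈ 𝒞.EmbIn M C, ∃ g ∈ 𝒞.EmbIn M C,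
    R = Set.range fun c => (f c, g c)

theorem IsClosedPartialIso.swap {R : Set (M × M)} (hR : IsClosedPartialIso 𝒞 R) :
    IsClosedPartialIso 𝒞 (Prod.swap '' R) := by
  obtain ⟨C, hC, f, hf, g, hg, rfl⟩ := hR
  exact ⟨C, hC, g, hg, f, hf, (Set.range_comp _ _).symm⟩

/-- Some closed member `T` of the exhausting chain contains both `x` and the domain `f[C]`; the
extension property along `C → T` extends `g` to `T`. -/
theorem exists_extension_left (hM : 𝒞.IsGeneric M) {R : Set (M × M)}
    (hR : IsClosedPartialIso 𝒞 R) (x : M) :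
    ∃ R', IsClosedPartialIso 𝒞 R' ∧ R ⊆ R' ∧ ∃ y, (x, y) ∈ R' := by
  obtain ⟨C, hC, f, hf, g, hg, rfl⟩ := hR
  have : Finite C := 𝒞.finite_of_mem C hC
  obtain ⟨S, hmono, hS, hcov⟩ := hM.exists_chain
  choose i hi using hcov
  obtain ⟨N, hN⟩ : ∃ N, ∀ c, i (f c) ≤ N := by
    obtain ⟨N, hN⟩ := (Set.finite_range fun c => i (f c)).bddAbove
    exact ⟨N, fun c => hN ⟨c, rfl⟩⟩
  let T := S (max N (i x))
  have hfT : ∀ c, f c ∈ T := fun c => hmono ((hN c).trans (le_max_left _ _)) (hi _)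
  have hxT : x ∈ T := hmono (le_max_right _ _) (hi _)
  have hT := hS (max N (i x))
  obtain ⟨g', hg', hgg'⟩ := hM.extension C T hC (hM.mem_carrier T hT.1) _
    (hM.codRestrict_mem_Emb hf hT.1 hfT) g hg
  refine ⟨_, ⟨⟨T, inferInstance⟩, hM.mem_carrier T hT.1, T.subtype, ?_, g', hg', rfl⟩, ?_,
    g' ⟨x, hxT⟩, ⟨x, hxT⟩, rfl⟩
  · change 𝒞.ClosedIn _
    rw [FirstOrder.Language.Substructure.range_subtype]
    exact hT.2
  · rintro _ ⟨c, rfl⟩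
    refine ⟨⟨f c, hfT c⟩, Prod.ext rfl ?_⟩
    rw [← hgg']
    rfl

theorem exists_extension_right (hM : 𝒞.IsGeneric M) {R : Set (M × M)}
    (hR : IsClosedPartialIso 𝒞 R) (y : M) :
    ∃ R', IsClosedPartialIso 𝒞 R' ∧ R ⊆ R' ∧ ∃ x, (x, y) ∈ R' := by
  obtain ⟨R', hR', hRR', x, hx⟩ := hM.exists_extension_left hR.swap y
  refine ⟨_, hR'.swap, fun p hp => ⟨p.swap, hRR' ⟨p, hp, rfl⟩, p.swap_swap⟩, x, (y, x), hx, rfl⟩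

/-- Two closed embeddings of a member of the class into the generic structure differ by an
automorphism. -/
theorem homogeneous [L.IsRelational] [Countable M] (hM : 𝒞.IsGeneric M) {A : Type w}
    [L.Structure A] (hA : bundle L A ∈ 𝒞.carrier) {f g : A ↪[L] M} (hf : f ∈ 𝒞.EmbIn M A)
    (hg : g ∈ 𝒞.EmbIn M A) : ∃ e : M ≃[L] M, ∀ a, e (f a) = g a := by
  let Q := {R : Set (M × M) // IsClosedPartialIso 𝒞 R}
  -- Back-and-forth as genericity: an ideal of partial isomorphisms meeting these countably many
  -- cofinal sets is total on both sides.
  let D : M ⊕ M → Order.Cofinal Q := fun i => i.elim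
    (fun x => ⟨{R | ∃ y, (x, y) ∈ R.1}, fun R =>
      let ⟨R', h1, h2, h3⟩ := hM.exists_extension_left R.2 x
      ⟨⟨R', h1⟩, h3, h2⟩⟩)
    (fun y => ⟨{R | ∃ x, (x, y) ∈ R.1}, fun R =>
      let ⟨R', h1, h2, h3⟩ := hM.exists_extension_right R.2 y
      ⟨⟨R', h1⟩, h3, h2⟩⟩)
  let R₀ : Q := ⟨_, ⟨A, inferInstance⟩, hA, f, hf, g, hg, rfl⟩
  let : Encodable (M ⊕ M) := Encodable.ofCountable _
  let I := Order.idealOfCofinals R₀ D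
  have hl : ∀ x, ∃ y, ∃ R ∈ I, (x, y) ∈ R.1 := fun x =>
    let ⟨R, ⟨y, hy⟩, hR⟩ := Order.cofinal_meets_idealOfCofinals R₀ D (Sum.inl x)
    ⟨y, R, hR, hy⟩
  have hr : ∀ y, ∃ x, ∃ R ∈ I, (x, y) ∈ R.1 := fun y =>
    let ⟨R, ⟨x, hx⟩, hR⟩ := Order.cofinal_meets_idealOfCofinals R₀ D (Sum.inr y)
    ⟨x, R, hR, hx⟩
  choose F RF hRF hF using hl
  choose G RG hRG hG using hr
  have hfun : ∀ x y, ∀ R ∈ I, (x, y) ∈ R.1 → F x = y := by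
    intro x y R hR hxy
    obtain ⟨⟨R', C, hC, f', hf', g', hg', rfl⟩, -, h1, h2⟩ := I.directed _ (hRF x) _ hR
    obtain ⟨c, hc⟩ := h1 (hF x)
    obtain ⟨d, hd⟩ := h2 hxy
    simp only [Prod.mk.injEq] at hc hd
    have hcd : c = d := f'.injective (hc.1.trans hd.1.symm)
    rw [← hc.2, ← hd.2, hcd]
  have hfun' : ∀ x y, ∀ R ∈ I, (x, y) ∈ R.1 → G y = x := by
    intro x y R hR hxy
    obtain ⟨⟨R', C, hC, f', hf', g', hg', rfl⟩, -, h1, h2⟩ := I.directed _ (hRG y) _ hR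
    obtain ⟨c, hc⟩ := h1 (hG y)
    obtain ⟨d, hd⟩ := h2 hxy
    simp only [Prod.mk.injEq] at hc hd
    have hcd : c = d := g'.injective (hc.2.trans hd.2.symm)
    rw [← hc.1, ← hd.1, hcd]
  refine ⟨⟨⟨F, G, fun x => hfun' x _ _ (hRF x) (hF x), fun y => hfun _ y _ (hRG y) (hG y)⟩,
    fun φ => isEmptyElim φ, fun {r} ρ x => ?_⟩, fun a => ?_⟩
  -- A relation involves only finitely many points, so by directedness a single partial isomorphism
  -- in the ideal decides it.
  · have hfin : ∀ s : Finset (Fin r), ∃ R ∈ I, ∀ j ∈ s, (x j, F (x j)) ∈ R.1 := by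
      intro s
      induction s using Finset.cons_induction with
      | empty => exact ⟨R₀, Order.mem_idealOfCofinals R₀ D, by simp⟩
      | cons j s hj ih =>
        obtain ⟨R, hR, h⟩ := ih
        obtain ⟨R', hR', h1, h2⟩ := I.directed _ (hRF (x j)) _ hR
        refine ⟨R', hR', fun i hi => ?_⟩
        rcases Finset.mem_cons.1 hi with rfl | hi
        · exact h1 (hF _)
        · exact h2 (h i hi)
    obtain ⟨⟨R, C, hC, f', hf', g', hg', rfl⟩, -, h⟩ := hfin Finset.univ
    choose c hc using fun j => h j (Finset.mem_univ j)
    have h1 : x = f' ∘ c := funext fun j => (congrArg Prod.fst (hc j)).symm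
    have h2 : F ∘ x = g' ∘ c := funext fun j => (congrArg Prod.snd (hc j)).symm
    change FirstOrder.Language.Structure.RelMap ρ (F ∘ x) ↔ _
    rw [h2, h1, g'.map_rel, f'.map_rel]
  · exact hfun _ _ R₀ (Order.mem_idealOfCofinals R₀ D) ⟨a, rfl⟩

end IsGeneric

end SmoothClass

/-! ### Coloring the lines in a finite substructure -/

theorem ExhibitsConfigurations.exists_row {m n k : ℕ} {X : Matrix (Fin m) (Fin n) ℝ}
    (hX : ExhibitsConfigurations k X) (s : Finset (Fin n)) (hs : s.card ≤ k) (c : Fin n → Bool) :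
    ∃ j, ∀ i ∈ s, X j i = if c i then 1 else 0 := by
  obtain ⟨-, hkn, h⟩ := hX
  -- The condition concerns exactly `k` columns, so `s` is padded to size `k`, using `k ≤ n`.
  obtain ⟨t, hst, ht⟩ := Finset.exists_superset_card_eq hs (by simpa using hkn)
  obtain ⟨j, hj⟩ := h (fun i => if c (t.orderEmbOfFin ht i) then 1 else 0)
    (fun i => by by_cases hc : c (t.orderEmbOfFin ht i) <;> simp [hc]) (t.orderEmbOfFin ht)
    (t.orderEmbOfFin ht).strictMono
  refine ⟨j, fun i hi => ?_⟩
  obtain ⟨r, rfl⟩ : i ∈ Set.range (t.orderEmbOfFin ht) := by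
    rw [Finset.range_orderEmbOfFin]
    exact hst hi
  exact hj r

/-- The colors of the positions `p i` under `Λ` are the entries of a row of `X`. -/
def IsRowColored {L : FirstOrder.Language.{u, v}} {M B : Type w} [L.Structure M] [L.Structure B]
    {m n : ℕ} (X : Matrix (Fin m) (Fin n) ℝ) (p : Fin n → L.Substructure B)
    (χ : L.Substructure M → Bool) (Λ : B ↪[L] M) : Prop :=
  ∃ j, ∀ i, X j i = if χ ((p i).map Λ.toHom) then 1 else 0

namespace SmoothClass

variable {L : FirstOrder.Language.{u, v}} {𝒞 : SmoothClass.{u, v, w} L}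

section Coloring

variable {M A B : Type w} [L.Structure M] [L.Structure A] [L.Structure B]

theorem remaining_subset (k : ℕ) (l : List (B ↪[L] M)) (𝓛 : Set (B ↪[L] M)) :
    𝒞.remaining A k 𝓛 l ⊆ 𝓛 := by
  induction l generalizing 𝓛 with
  | nil => exact subset_rfl
  | cons Λ l ih =>
    refine (ih _).trans ?_
    split_ifs
    exacts [Set.sdiff_subset, subset_rfl]

theorem map_mem_points [L.IsRelational] (hM : 𝒞.IsGeneric M) (hB : bundle L B ∈ 𝒞.carrier)
    {S : L.Substructure B} (hS : S ∈ 𝒞.copies B A) {Λ : B ↪[L] M} (hΛ : Λ ∈ 𝒞.EmbIn M B) :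
    S.map Λ.toHom ∈ 𝒞.points M A := by
  obtain ⟨Γ, hΓ, rfl⟩ := hS
  exact ⟨_, hM.comp_mem_EmbIn hB hΛ hΓ,
    FirstOrder.Language.Hom.range_comp Γ.toHom Λ.toHom⟩

open Classical in
-- At most `k` positions of `Λ` are shared with other lines. A row agreeing with `χ` there can be
-- written along `Λ` without changing any color seen by another line.
theorem exists_rowColored_insert {k m n : ℕ} {X : Matrix (Fin m) (Fin n) ℝ}
    (hX : ExhibitsConfigurations k X) {p : Fin n → L.Substructure B} (hp : Function.Injective p)
    {𝓛 : Set (B ↪[L] M)} {Λ : B ↪[L] M} (hpt : ∀ i, (p i).map Λ.toHom ∈ 𝒞.points M A)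
    (hsh : (𝒞.sharedPoints A 𝓛 Λ).encard ≤ k) {χ : L.Substructure M → Bool}
    (hχ : ∀ Λ' ∈ 𝓛 \ {Λ}, IsRowColored X p χ Λ') :
    ∃ χ', ∀ Λ' ∈ 𝓛, IsRowColored X p χ' Λ' := by
  have hinj : Function.Injective fun i => (p i).map Λ.toHom :=
    (FirstOrder.Language.Substructure.map_injective_of_injective Λ.injective).comp hp
  let s : Finset (Fin n) :=
    Finset.univ.filter fun i => (p i).map Λ.toHom ∈ 𝒞.sharedPoints A 𝓛 Λ
  have hs : s.card ≤ k := by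
    have h : (s : Set (Fin n)).encard ≤ k := by
      rw [← hinj.encard_image]
      refine (Set.encard_le_encard ?_).trans hsh
      rintro _ ⟨i, hi, rfl⟩
      exact (Finset.mem_filter.1 hi).2
    rw [Set.encard_coe_eq_coe_finsetCard] at h
    exact_mod_cast h
  obtain ⟨j, hj⟩ := hX.exists_row s hs fun i => χ ((p i).map Λ.toHom)
  -- The chosen index is unambiguous because the positions on `Λ` are distinct.
  let χ' : L.Substructure M → Bool := fun S =>
    if h : ∃ i, (p i).map Λ.toHom = S then decide (X j h.choose = 1) else χ S
  have hχ' : ∀ i, χ' ((p i).map Λ.toHom) = decide (X j i = 1) := by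
    intro i
    have h : ∃ i', (p i').map Λ.toHom = (p i).map Λ.toHom := ⟨i, rfl⟩
    simp only [χ', dif_pos h]
    rw [hinj h.choose_spec]
  refine ⟨χ', fun Λ' hΛ' => ?_⟩
  by_cases hΛ : Λ' = Λ
  · subst hΛ
    refine ⟨j, fun i => ?_⟩
    rw [hχ']
    rcases hX.1 j i with h | h <;> simp [h]
  · obtain ⟨j', hj'⟩ := hχ Λ' ⟨hΛ', hΛ⟩
    refine ⟨j', fun i => ?_⟩
    rw [hj' i]
    suffices χ' ((p i).map Λ'.toHom) = χ ((p i).map Λ'.toHom) by rw [this]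
    -- A position of `Λ'` that is also one of `Λ` is a shared point, where the new row agrees with
    -- `χ`.
    by_cases h : ∃ i', (p i').map Λ.toHom = (p i).map Λ'.toHom
    · obtain ⟨i', hi'⟩ := h
      rw [← hi', hχ']
      have h := hj i' (Finset.mem_filter.2 ⟨Finset.mem_univ _, hpt i',
        FirstOrder.Language.Hom.map_le_range, Λ', hΛ', hΛ,
        hi' ▸ FirstOrder.Language.Hom.map_le_range⟩)
      rw [h]
      cases χ ((p i').map Λ.toHom) <;> simp
    · exact dif_neg h

theorem exists_rowColored_of_remaining_eq_empty {k m n : ℕ} {X : Matrix (Fin m) (Fin n) ℝ}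
    (hX : ExhibitsConfigurations k X) {p : Fin n → L.Substructure B} (hp : Function.Injective p)
    (l : List (B ↪[L] M)) (hpt : ∀ Λ ∈ l, ∀ i, (p i).map Λ.toHom ∈ 𝒞.points M A)
    (𝓛 : Set (B ↪[L] M)) (hl : 𝒞.remaining A k 𝓛 l = ∅) :
    ∃ χ, ∀ Λ ∈ 𝓛, IsRowColored X p χ Λ := by
  induction l generalizing 𝓛 with
  | nil =>
    have h : 𝓛 = ∅ := hl
    exact ⟨fun _ => false, by simp [h]⟩
  | cons Λ l ih =>
    have ih' := ih fun Λ' h => hpt Λ' (List.mem_cons_of_mem _ h)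
    rw [remaining] at hl
    split_ifs at hl with hsh
    · obtain ⟨χ, hχ⟩ := ih' _ hl
      exact exists_rowColored_insert hX hp (hpt Λ List.mem_cons_self) hsh hχ
    · exact ih' _ hl

theorem IsFreePseudoplaneIn.exists_rowColored [L.IsRelational] (hM : 𝒞.IsGeneric M)
    (hB : bundle L B ∈ 𝒞.carrier) {k m n : ℕ} (hn : 0 < n) {X : Matrix (Fin m) (Fin n) ℝ}
    (hX : ExhibitsConfigurations k X) {p : Fin n → L.Substructure B} (hp : Function.Injective p)
    (hpc : ∀ i, p i ∈ 𝒞.copies B A) {T : L.Substructure M}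
    (hT : 𝒞.IsFreePseudoplaneIn A B k T) :
    ∃ χ, ∀ Λ ∈ 𝒞.lines B T, IsRowColored X p χ Λ := by
  obtain ⟨l, -, hl, hrem⟩ := hT
  refine exists_rowColored_of_remaining_eq_empty hX hp l
    (fun Λ hΛ i => map_mem_points hM hB (hpc i) ((hl Λ).1 hΛ).1) _ ?_
  refine Set.eq_empty_of_forall_notMem fun Λ hΛ => ?_
  -- Since `n > 0`, every line carries an `A`-point, so no line can remain.
  exact hrem Λ hΛ _ (map_mem_points hM hB (hpc ⟨0, hn⟩) (remaining_subset _ _ _ hΛ).1)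
    FirstOrder.Language.Hom.map_le_range

end Coloring

end SmoothClass

/-! ### The compact space of row colorings and the action on it -/

/-- The finite substructures of `M`. -/
abbrev FiniteSubstructure (L : FirstOrder.Language.{u, v}) (M : Type w) [L.Structure M] : Type w :=
  {S : L.Substructure M // (S : Set M).Finite}

namespace FiniteSubstructure

variable {L : FirstOrder.Language.{u, v}} {M B : Type w} [L.Structure M] [L.Structure B]

/-- The image of a substructure of a finite structure. -/
def ofMap [Finite B] (Λ : B ↪[L] M) (S : L.Substructure B) : FiniteSubstructure L M :=
  ⟨S.map Λ.toHom, S.1.toFinite.image _⟩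

/-- The preimage of a finite substructure under an automorphism. -/
def comap (e : M ≃[L] M) (S : FiniteSubstructure L M) : FiniteSubstructure L M :=
  ⟨S.1.comap e.toHom, Set.Finite.preimage (f := e) e.injective.injOn S.2⟩

theorem comap_ofMap [Finite B] (e : M ≃[L] M) (Λ : B ↪[L] M) (S : L.Substructure B) :
    comap e (ofMap Λ S) = ofMap (e.symm.toEmbedding.comp Λ) S := by
  refine Subtype.ext (SetLike.ext fun x => ?_)
  constructor
  · rintro ⟨y, hy, hyx⟩
    exact ⟨y, hy, (congrArg e.symm hyx).trans (e.symm_apply_apply x)⟩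
  · rintro ⟨y, hy, rfl⟩
    exact ⟨y, hy, (e.apply_symm_apply (Λ y)).symm⟩

theorem comap_eq_of_eqOn {e e₀ : M ≃[L] M} {S : FiniteSubstructure L M}
    (h : ∀ x ∈ (comap e₀ S).1, e x = e₀ x) : comap e S = comap e₀ S := by
  refine Subtype.ext (SetLike.ext fun x => ⟨fun hx => ?_, fun hx => ?_⟩)
  -- The point `e₀⁻¹ (e x)` has the same image under `e` as `x`, hence equals `x`.
  · have hy : e₀.symm (e x) ∈ (comap e₀ S).1 := by
      change e₀ (e₀.symm (e x)) ∈ S.1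
      rw [e₀.apply_symm_apply]
      exact hx
    have h' := h _ hy
    rw [e₀.apply_symm_apply] at h'
    rwa [← e.injective h']
  · change e x ∈ S.1
    rw [h x hx]
    exact hx

/-- The preimage of the finite `S` is locally constant in the automorphism, so near each point the
map is evaluation at a fixed coordinate. -/
theorem continuous_apply_comap (S : FiniteSubstructure L M) :
    Continuous fun q : (M ≃[L] M) × (FiniteSubstructure L M → Bool) => q.2 (comap q.1 S) := by
  refine continuous_iff_continuousAt.2 fun ⟨e₀, χ₀⟩ => ?_
  have h1 : ∀ᶠ q in nhds (e₀, χ₀), comap q.1 S = comap e₀ S := by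
    have h : ∀ᶠ e in nhds e₀, ∀ x ∈ (comap e₀ S).1, e x = e₀ x := by
      refine (Filter.eventually_all_finite (comap e₀ S).2).2 fun x _ => ?_
      let : TopologicalSpace M := ⊥
      have : DiscreteTopology M := ⟨rfl⟩
      have hc : Continuous fun e : M ≃[L] M => e x :=
        (continuous_apply x).comp continuous_induced_dom
      exact ((isOpen_discrete {e₀ x}).preimage hc).mem_nhds rfl
    exact (continuous_fst.tendsto (e₀, χ₀)).eventually (h.mono fun e he => comap_eq_of_eqOn he)
  have h2 : ContinuousAt (fun q : (M ≃[L] M) × (FiniteSubstructure L M → Bool) =>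
      q.2 (comap e₀ S)) (e₀, χ₀) :=
    ((continuous_apply _).comp continuous_snd).continuousAt
  exact h2.congr (h1.mono fun q hq => by simp only [hq])

end FiniteSubstructure

namespace SmoothClass

variable {L : FirstOrder.Language.{u, v}} (𝒞 : SmoothClass.{u, v, w} L)
  {M B : Type w} [L.Structure M] [L.Structure B] [Finite B] {m n : ℕ}

/-- The colorings of the finite substructures of `M` such that the colors of the positions `p i`
on every `B`-line are the entries of a row of `X`. -/
def rowColorings (M : Type w) [L.Structure M] (X : Matrix (Fin m) (Fin n) ℝ)
    (p : Fin n → L.Substructure B) : Set (FiniteSubstructure L M → Bool) :=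
  {χ | ∀ Λ ∈ 𝒞.EmbIn M B, ∃ j, ∀ i,
    X j i = if χ (FiniteSubstructure.ofMap Λ (p i)) then 1 else 0}

variable (X : Matrix (Fin m) (Fin n) ℝ) (p : Fin n → L.Substructure B)

theorem isClosed_setOf_exists_row (Λ : B ↪[L] M) :
    IsClosed {χ : FiniteSubstructure L M → Bool | ∃ j, ∀ i,
      X j i = if χ (FiniteSubstructure.ofMap Λ (p i)) then 1 else 0} := by
  have hc : Continuous fun (χ : FiniteSubstructure L M → Bool) (i : Fin n) =>
      χ (FiniteSubstructure.ofMap Λ (p i)) := continuous_pi fun i => continuous_apply _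
  exact (isClosed_discrete {c : Fin n → Bool | ∃ j, ∀ i, X j i = if c i then 1 else 0}).preimage hc

theorem isClosed_rowColorings : IsClosed (𝒞.rowColorings M X p) := by
  have h : 𝒞.rowColorings M X p = ⋂ Λ ∈ 𝒞.EmbIn M B, {χ | ∃ j, ∀ i,
      X j i = if χ (FiniteSubstructure.ofMap Λ (p i)) then 1 else 0} := by
    ext χ
    simp only [rowColorings, Set.mem_iInter, Set.mem_ofPred_eq]
  rw [h]
  exact isClosed_biInter fun Λ _ => isClosed_setOf_exists_row X p Λ

variable {𝒞} {X} {p}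

theorem IsGeneric.comap_mem_rowColorings (hM : 𝒞.IsGeneric M) (e : M ≃[L] M)
    {χ : FiniteSubstructure L M → Bool} (hχ : χ ∈ 𝒞.rowColorings M X p) :
    (fun S => χ (FiniteSubstructure.comap e S)) ∈ 𝒞.rowColorings M X p := by
  intro Λ hΛ
  simp only [FiniteSubstructure.comap_ofMap]
  exact hχ _ (hM.equiv_comp_mem_EmbIn e.symm hΛ)

/-- Each line imposes a closed condition, and finitely many lines lie in a finite substructure,
where the free pseudoplane condition gives a coloring. -/
theorem IsFreePseudoplane.rowColorings_nonempty [L.IsRelational] {A : Type w} [L.Structure A]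
    (hM : 𝒞.IsGeneric M) (hB : bundle L B ∈ 𝒞.carrier) {k : ℕ} (hn : 0 < n)
    (hX : ExhibitsConfigurations k X) (hp : Function.Injective p)
    (hpc : ∀ i, p i ∈ 𝒞.copies B A) (hfree : 𝒞.IsFreePseudoplane M A B k) :
    (𝒞.rowColorings M X p).Nonempty := by
  have h := isCompact_univ.inter_iInter_nonempty
    (fun Λ : 𝒞.EmbIn M B => {χ : FiniteSubstructure L M → Bool | ∃ j, ∀ i,
      X j i = if χ (FiniteSubstructure.ofMap Λ.1 (p i)) then 1 else 0})
    (fun Λ => isClosed_setOf_exists_row X p Λ.1) ?_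
  · obtain ⟨χ, -, hχ⟩ := h
    exact ⟨χ, fun Λ hΛ => Set.mem_iInter.1 hχ ⟨Λ, hΛ⟩⟩
  · intro F
    let T : L.Substructure M := FirstOrder.Language.Substructure.closure L
      (⋃ Λ ∈ F, Set.range Λ.1)
    have hTeq : (T : Set M) = ⋃ Λ ∈ F, Set.range Λ.1 :=
      FirstOrder.Language.Substructure.closure_eq_of_isRelational L _
    have hT : (T : Set M).Finite := by
      rw [hTeq]
      exact F.finite_toSet.biUnion fun Λ _ => Set.finite_range _
    obtain ⟨χ, hχ⟩ := (hfree T hT).exists_rowColored hM hB hn hX hp hpc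
    refine ⟨fun S => χ S.1, Set.mem_univ _, Set.mem_iInter₂.2 fun Λ hΛ => ?_⟩
    refine hχ Λ.1 ⟨Λ.2, ?_⟩
    rintro _ ⟨b, rfl⟩
    exact hTeq.ge (Set.mem_biUnion hΛ ⟨b, rfl⟩)

variable (X p) in
/-- Automorphisms of the generic structure act on the row colorings. -/
@[reducible]
def IsGeneric.rowColoringsAction (hM : 𝒞.IsGeneric M) :
    MulAction (M ≃[L] M) (𝒞.rowColorings M X p) where
  smul e χ := ⟨fun S => χ.1 (FiniteSubstructure.comap e S), hM.comap_mem_rowColorings e χ.2⟩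
  one_smul _ := rfl
  mul_smul _ _ _ := rfl

theorem IsGeneric.exists_comap_ofMap_eq [L.IsRelational] [Countable M] {A : Type w}
    [L.Structure A] (hM : 𝒞.IsGeneric M) (hA : bundle L A ∈ 𝒞.carrier)
    (hB : bundle L B ∈ 𝒞.carrier) {S S' : L.Substructure B} (hS : S ∈ 𝒞.copies B A)
    (hS' : S' ∈ 𝒞.copies B A) {Λ : B ↪[L] M} (hΛ : Λ ∈ 𝒞.EmbIn M B) :
    ∃ e : M ≃[L] M, FiniteSubstructure.comap e (FiniteSubstructure.ofMap Λ S') =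
      FiniteSubstructure.ofMap Λ S := by
  obtain ⟨Γ, hΓ, rfl⟩ := hS
  obtain ⟨Γ', hΓ', rfl⟩ := hS'
  obtain ⟨e, he⟩ := hM.homogeneous hA (hM.comp_mem_EmbIn hB hΛ hΓ) (hM.comp_mem_EmbIn hB hΛ hΓ')
  refine ⟨e, Subtype.ext (SetLike.ext fun x => ⟨?_, ?_⟩)⟩
  · rintro ⟨_, ⟨a, rfl⟩, ha⟩
    refine ⟨_, ⟨a, rfl⟩, e.injective ?_⟩
    exact (he a).trans ha
  · rintro ⟨_, ⟨a, rfl⟩, rfl⟩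
    exact ⟨_, ⟨a, rfl⟩, (he a).symm⟩

end SmoothClass

/-! ### From an invariant measure to the convex Ramsey condition -/

/-- If some random row of a zero-one matrix has all its entries equally distributed, then the
matrix satisfies the convex Ramsey condition. -/
theorem isConvexRamsey_of_measure {Ω : Type*} [MeasurableSpace Ω] (μ : Measure Ω)
    [IsProbabilityMeasure μ] {m n : ℕ} {X : Matrix (Fin m) (Fin n) ℝ} (hX : IsZeroOne X)
    (r : Ω → Fin m) (hr : Measurable r) (c : ℝ)
    (hc : ∀ i, μ.real {ω | X (r ω) i = 1} = c) : IsConvexRamsey X := by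
  have : IsProbabilityMeasure (μ.map r) := Measure.isProbabilityMeasure_map hr.aemeasurable
  -- With `P` the distribution of `r`, every entry of `P X` is `c`; a Dirac weight then evaluates to
  -- `c - c = 0`.
  have hsum : ∀ i, ∑ j, (μ.map r).real {j} * X j i = c := by
    intro i
    rw [← hc i]
    have h : {ω | X (r ω) i = 1} = r ⁻¹' ↑(Finset.univ.filter fun j => X j i = 1) := by
      ext ω
      simp
    rw [h, ← map_measureReal_apply hr (Finset.measurableSet _), ← sum_measureReal_singleton,
      Finset.sum_filter]
    refine Finset.sum_congr rfl fun j _ => ?_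
    rcases hX j i with h | h <;> simp [h]
  refine ⟨fun j => (μ.map r).real {j}, ⟨fun j => measureReal_nonneg, ?_⟩, ?_⟩
  · rw [sum_measureReal_singleton, Finset.coe_univ, probReal_univ]
  · rintro W ⟨a, b, hab, ha, hb, hW⟩
    have h : ∀ j, X.mulVec W j = X j a - X j b := by
      intro j
      rw [Matrix.mulVec, dotProduct, ← Finset.sum_subset (Finset.subset_univ {a, b}),
        Finset.sum_pair hab, ha, hb]
      · ring
      · intro x _ hx
        simp only [Finset.mem_insert, Finset.mem_singleton, not_or] at hx
        rw [hW x hx.1 hx.2, mul_zero]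
    simp only [dotProduct, h, mul_sub, Finset.sum_sub_distrib, hsum]
    norm_num

theorem mainTheorem5 {L : FirstOrder.Language.{u, v}} [L.IsRelational] [Countable L.Symbols]
    (𝒞 : SmoothClass.{u, v, w} L) (hAP : 𝒞.AP)
    (M : Type w) [L.Structure M] [Countable M] (hM : 𝒞.IsGeneric M)
    (A B : Type w) [L.Structure A] [L.Structure B]
    (hA : bundle L A ∈ 𝒞.carrier) (hB : bundle L B ∈ 𝒞.carrier)
    (hne : (𝒞.EmbIn M B).Nonempty)
    (k n : ℕ) (hk : 2 ≤ k) (hkn : k < n) (hn : (𝒞.copies B A).ncard = n)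
    (hfree : 𝒞.IsFreePseudoplane M A B k)
    (m : ℕ) (X : Matrix (Fin m) (Fin n) ℝ)
    (hX : ExhibitsConfigurations k X) (hX' : ¬ IsConvexRamsey X) :
    ¬ IsAmenable (M ≃[L] M) := by
  intro ham
  have hn0 : 0 < n := by omega
  have : Finite B := 𝒞.finite_of_mem B hB
  have hfin : (𝒞.copies B A).Finite := Set.finite_of_ncard_pos (hn ▸ hn0)
  have : Finite (𝒞.copies B A) := hfin
  let enum : Fin n ≃ 𝒞.copies B A := (Finite.equivFinOfCardEq hn).symm
  let p : Fin n → L.Substructure B := fun i => (enum i).1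
  have hp : Function.Injective p := Subtype.val_injective.comp enum.injective
  have hpc : ∀ i, p i ∈ 𝒞.copies B A := fun i => (enum i).2
  let Y := 𝒞.rowColorings M X p
  have : CompactSpace Y := isCompact_iff_compactSpace.1 (𝒞.isClosed_rowColorings X p).isCompact
  have : Nonempty Y := (hfree.rowColorings_nonempty hM hB hn0 hX hp hpc).to_subtype
  let : MeasurableSpace Y := borel Y
  have : BorelSpace Y := ⟨rfl⟩
  let : MulAction (M ≃[L] M) Y := hM.rowColoringsAction X p
  have : ContinuousSMul (M ≃[L] M) Y := ⟨by
    refine Continuous.subtype_mk (continuous_pi fun S => ?_) _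
    exact (FiniteSubstructure.continuous_apply_comap S).comp
      (continuous_fst.prodMk (continuous_subtype_val.comp continuous_snd))⟩
  obtain ⟨μ, hμ, hinv⟩ := ham Y
  obtain ⟨Λ, hΛ⟩ := hne
  let t : Y → Fin n → Bool := fun χ i => χ.1 (FiniteSubstructure.ofMap Λ (p i))
  have ht : Continuous t := continuous_pi fun i => (continuous_apply _).comp continuous_subtype_val
  -- Choosing the row as a function of the color pattern makes it factor through a finite discrete
  -- space, hence measurable. Patterns that never occur get an arbitrary row.
  have hrow : ∀ c : Fin n → Bool, ∃ j, c ∈ Set.range t → ∀ i, X j i = if c i then 1 else 0 := by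
    intro c
    by_cases hc : c ∈ Set.range t
    · obtain ⟨χ, rfl⟩ := hc
      obtain ⟨j, hj⟩ := χ.2 Λ hΛ
      exact ⟨j, fun _ => hj⟩
    · obtain ⟨j, -⟩ := hX.exists_row ∅ (by simp) c
      exact ⟨j, fun h => absurd h hc⟩
  choose r hr using hrow
  have hrt : Measurable (r ∘ t) := fun s _ => ((isOpen_discrete (r ⁻¹' s)).preimage ht).measurableSet
  let E : Fin n → Set Y := fun i => {χ | t χ i = true}
  have hE : ∀ i, {χ | X ((r ∘ t) χ) i = 1} = E i := by
    intro i
    ext χ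
    have h := hr (t χ) ⟨χ, rfl⟩ i
    change X (r (t χ)) i = 1 ↔ t χ i = true
    rw [h]
    simp
  have hEm : ∀ i, MeasurableSet (E i) := fun i =>
    ((isOpen_discrete {c : Fin n → Bool | c i = true}).preimage ht).measurableSet
  refine hX' (isConvexRamsey_of_measure μ hX.1 (r ∘ t) hrt (μ.real (E ⟨0, hn0⟩)) fun i => ?_)
  rw [hE]
  -- Acting by `e` turns the color at position `i` into the color at position `0`, so invariance
  -- gives both events the same measure.
  obtain ⟨e, he⟩ := hM.exists_comap_ofMap_eq hA hB (hpc ⟨0, hn0⟩) (hpc i) hΛ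
  have hmeas : Measurable fun χ : Y => e • χ := (continuous_const_smul e).measurable
  have hpre : (fun χ : Y => e • χ) ⁻¹' E i = E ⟨0, hn0⟩ := by
    ext χ
    change χ.1 (FiniteSubstructure.comap e (FiniteSubstructure.ofMap Λ (p i))) = true ↔ _
    rw [he]
    rfl
  rw [← hpre, ← map_measureReal_apply hmeas (hEm i), hinv e]
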